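/- Let $A$ be an associative unital ring (for instance an algebra over a commutative ring $k$) and let $\mathfrak C$ be an $A$-coring, i.e. an $A$-bimodule with a coassociative coproduct $\Delta:\mathfrak C\to\mathfrak C\otimes_A\mathfrak C$ and a counit $\varepsilon:\mathfrak C\to A$, both bimodule maps. A right $\mathfrak C$-coaction on a right $A$-module $M$ is a right $A$-linear, coassociative and counital map $M\to M\otimes_A\mathfrak C$; a right $\mathfrak C$-comodule is a right $A$-module with a fixed coaction. For a right $\mathfrak C$-comodule $(M,\varrho^M)$ let $Z^1(\mathfrak C,M)$ be the set of all right $\mathfrak C$-coactions $F$ on the right $A$-module $M$. The group $\mathrm{Aut}_A(M)$ acts on it from the right by $(F,f)\mapsto (f^{-1}\otimes_A\mathfrak C)\circ F\circ f$, and $D^1(\mathfrak C,M)$ is the quotient of $Z^1(\mathfrak C,M)$ by this action, pointed by the class of $\varrho^M$. Let $(\Sigma,\varrho^\Sigma)$ be a right $\mathfrak C$-comodule and let $B=\mathrm{End}^{\mathfrak C}(\Sigma)$ be the ring of its comodule endomorphisms, which acts on $\Sigma$ from the left by evaluation. Suppose that $\Sigma$ is a Galois comodule, that is, $\Sigma$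 is finitely generated and projective as a right $A$-module and the evaluation map $\mathrm{Hom}^{\mathfrak C}(\Sigma,\mathfrak C)\otimes_B\Sigma\to\mathfrak C$, $f\otimes s\mapsto f(s)$, is an isomorphism of right $\mathfrak C$-comodules. Suppose also that $\Sigma$ is faithfully flat as a left $B$-module. Let $N$ be a right $B$-module. A $\Sigma$-twisted form of $N$ is a pair $(P,\phi)$ of a right $B$-module $P$ and a right $A$-module isomorphism $\phi:P\otimes_B\Sigma\to N\otimes_B\Sigma$; two such pairs $(P,\phi)$, $(Q,\psi)$ are equivalent if $P\cong Q$ as right $B$-modules. Let $\mathrm{Twist}_\Sigma(N)$ be the set of equivalence classes, pointed by the class of $(N,\mathrm{id}_{N\otimes_B\Sigma})$. Then, for every right $B$-module $N$, there is an isomorphism of pointed sets $$D^1(\mathfrak C,N\otimes_B\Sigma)\;\cong\;\mathrm{Twist}_\Sigma(N),$$ where $N\otimes_B\Sigma$ is a right $\mathfrak C$-comodule with the induced coaction $N\otimes_B\varrho^\Sigma$. -/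

import Mathlib

open MulOpposite
open scoped TensorProduct

universe u

noncomputable section

/-!
Right modules over a ring `R` are modules over `Rᵐᵒᵖ`, so that `m r` is written `op r • m`.
An `(R, S)`-bimodule carries `Module R`, `Module Sᵐᵒᵖ` and `SMulCommClass R Sᵐᵒᵖ`.
-/

/-! ### The tensor product over a non-commutative ring -/

/-- The subgroup of `M ⊗[ℤ] N` generated by the elements `m r ⊗ n - m ⊗ r n`. -/
def NCTensor.relations (R M N : Type*) [Ring R] [AddCommGroup M] [Module Rᵐᵒᵖ M]
    [AddCommGroup N] [Module R N] : AddSubgroup (M ⊗[ℤ] N) :=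
  AddSubgroup.closure
    {x | ∃ (m : M) (r : R) (n : N), x = (op r • m) ⊗ₜ[ℤ] n - m ⊗ₜ[ℤ] (r • n)}

/-- The tensor product over a ring `R` of a right `R`-module `M` and a left `R`-module `N`. -/
def NCTensor (R M N : Type*) [Ring R] [AddCommGroup M] [Module Rᵐᵒᵖ M]
    [AddCommGroup N] [Module R N] : Type _ :=
  (M ⊗[ℤ] N) ⧸ NCTensor.relations R M N

namespace NCTensor

section Basic

variable {R M N P M' N' M'' N'' : Type*} [Ring R]
  [AddCommGroup M] [Module Rᵐᵒᵖ M] [AddCommGroup N] [Module R N] [AddCommGroup P]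
  [AddCommGroup M'] [Module Rᵐᵒᵖ M'] [AddCommGroup N'] [Module R N']
  [AddCommGroup M''] [Module Rᵐᵒᵖ M''] [AddCommGroup N''] [Module R N'']

instance : AddCommGroup (NCTensor R M N) :=
  inferInstanceAs (AddCommGroup ((M ⊗[ℤ] N) ⧸ NCTensor.relations R M N))

variable (R) in
/-- The pure tensor `m ⊗ n`. -/
def tmul (m : M) (n : N) : NCTensor R M N :=
  QuotientAddGroup.mk' (NCTensor.relations R M N) (m ⊗ₜ[ℤ] n)

theorem add_tmul (m m' : M) (n : N) : tmul R (m + m') n = tmul R m n + tmul R m' n := by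
  simp only [tmul, TensorProduct.add_tmul, map_add]
  rfl

theorem tmul_add (m : M) (n n' : N) : tmul R m (n + n') = tmul R m n + tmul R m n' := by
  simp only [tmul, TensorProduct.tmul_add, map_add]
  rfl

theorem smul_tmul (r : R) (m : M) (n : N) : tmul R (op r • m) n = tmul R m (r • n) := by
  refine sub_eq_zero.1 ?_
  exact (QuotientAddGroup.eq_zero_iff (N := NCTensor.relations R M N)
    ((op r • m) ⊗ₜ[ℤ] n - m ⊗ₜ[ℤ] (r • n))).2
    (AddSubgroup.subset_closure ⟨m, r, n, rfl⟩)

theorem zero_tmul (n : N) : tmul R (0 : M) n = 0 := by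
  have h := add_tmul (R := R) (0 : M) 0 n
  simpa using h

theorem tmul_zero (m : M) : tmul R m (0 : N) = 0 := by
  have h := tmul_add (R := R) m (0 : N) 0
  simpa using h

@[elab_as_elim]
theorem induction_on {motive : NCTensor R M N → Prop} (x : NCTensor R M N)
    (zero : motive 0) (tmul : ∀ m n, motive (tmul R m n))
    (add : ∀ x y, motive x → motive y → motive (x + y)) : motive x := by
  obtain ⟨y, rfl⟩ := QuotientAddGroup.mk'_surjective _ x
  induction y using TensorProduct.induction_on with
  | zero => exact zero
  | tmul m n => exact tmul m n
  | add a b ha hb => exact add _ _ ha hb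

/-- The additive map out of `M ⊗ N` given by a biadditive `R`-balanced map. -/
def lift (f : M →+ N →+ P) (hf : ∀ (m : M) (r : R) (n : N), f (op r • m) n = f m (r • n)) :
    NCTensor R M N →+ P :=
  QuotientAddGroup.lift (NCTensor.relations R M N)
    (TensorProduct.liftAddHom f (fun z m n => by simp))
    (by
      rw [NCTensor.relations, AddSubgroup.closure_le]
      rintro _ ⟨m, r, n, rfl⟩
      simp [hf])

@[simp]
theorem lift_tmul (f : M →+ N →+ P)
    (hf : ∀ (m : M) (r : R) (n : N), f (op r • m) n = f m (r • n)) (m : M) (n : N) :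
    lift f hf (tmul R m n) = f m n :=
  rfl

theorem hom_ext {f g : NCTensor R M N →+ P} (h : ∀ m n, f (tmul R m n) = g (tmul R m n)) :
    f = g := by
  ext x
  induction x using induction_on with
  | zero => simp
  | tmul m n => exact h m n
  | add x y hx hy => simp only [map_add, hx, hy]

/-- The map `f ⊗ g`. -/
def map (f : M →ₗ[Rᵐᵒᵖ] M') (g : N →ₗ[R] N') : NCTensor R M N →+ NCTensor R M' N' :=
  lift
    (AddMonoidHom.mk'
      (fun m => AddMonoidHom.mk' (fun n => tmul R (f m) (g n))
        (fun a b => by rw [map_add, tmul_add]))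
      (fun a b => by ext n; simp [add_tmul]))
    (fun m r n => by simp [smul_tmul])

@[simp]
theorem map_tmul (f : M →ₗ[Rᵐᵒᵖ] M') (g : N →ₗ[R] N') (m : M) (n : N) :
    map f g (tmul R m n) = tmul R (f m) (g n) :=
  rfl

theorem map_map (f' : M' →ₗ[Rᵐᵒᵖ] M'') (g' : N' →ₗ[R] N'') (f : M →ₗ[Rᵐᵒᵖ] M')
    (g : N →ₗ[R] N') (x : NCTensor R M N) :
    map f' g' (map f g x) = map (f' ∘ₗ f) (g' ∘ₗ g) x :=
  DFunLike.congr_fun (hom_ext (f := (map f' g').comp (map f g))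
    (g := map (f' ∘ₗ f) (g' ∘ₗ g)) (fun _ _ => rfl)) x

theorem map_id_id (x : NCTensor R M N) :
    map (LinearMap.id : M →ₗ[Rᵐᵒᵖ] M) (LinearMap.id : N →ₗ[R] N) x = x :=
  DFunLike.congr_fun (hom_ext (f := map LinearMap.id LinearMap.id)
    (g := AddMonoidHom.id (NCTensor R M N)) (fun _ _ => rfl)) x

/-- The canonical map `R ⊗ N → N`. -/
def lid : NCTensor R R N →+ N :=
  lift (AddMonoidHom.mk' (fun r => AddMonoidHom.mk' (fun n => r • n) (smul_add r))
      (fun a b => by ext n; simp [add_smul]))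
    (fun m r n => by simp [mul_smul])

@[simp]
theorem lid_tmul (r : R) (n : N) : lid (tmul R r n) = r • n :=
  rfl

/-- The canonical map `M ⊗ R → M`. -/
def rid : NCTensor R M R →+ M :=
  lift (AddMonoidHom.mk' (fun m => AddMonoidHom.mk' (fun r => op r • m)
        (fun a b => by simp [add_smul]))
      (fun a b => by ext n; simp))
    (fun m r n => by simp [mul_smul])

@[simp]
theorem rid_tmul (m : M) (r : R) : rid (tmul R m r) = op r • m :=
  rfl

end Basic

section Actions

variable {R S T M N M' N' : Type*} [Ring R] [Ring S] [Ring T]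
  [AddCommGroup M] [Module Rᵐᵒᵖ M] [AddCommGroup N] [Module R N]
  [AddCommGroup M'] [Module Rᵐᵒᵖ M'] [AddCommGroup N'] [Module R N']

/-- If `M` is an `(S, R)`-bimodule, then `M ⊗ N` is a left `S`-module. -/
instance leftModule [Module S M] [SMulCommClass S Rᵐᵒᵖ M] : Module S (NCTensor R M N) where
  smul s := map (DistribSMul.toLinearMap Rᵐᵒᵖ M s) LinearMap.id
  one_smul x := by
    change map _ _ x = x
    induction x using induction_on with
    | zero => simp
    | tmul m n => simp
    | add x y hx hy => simp only [map_add, hx, hy]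
  mul_smul s t x := by
    change map _ _ x = map _ _ (map _ _ x)
    induction x using induction_on with
    | zero => simp
    | tmul m n => simp [mul_smul]
    | add x y hx hy => simp only [map_add, hx, hy]
  smul_zero s := map_zero _
  smul_add s := map_add _
  add_smul s t x := by
    change map _ _ x = map _ _ x + map _ _ x
    induction x using induction_on with
    | zero => simp
    | tmul m n => simp [add_smul, add_tmul]
    | add x y hx hy => simp only [map_add, hx, hy]; abel
  zero_smul x := by
    change map _ _ x = 0
    induction x using induction_on with
    | zero => simp
    | tmul m n => simp [zero_tmul]
    | add x y hx hy => simp only [map_add, hx, hy, add_zero]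

theorem smul_def_left [Module S M] [SMulCommClass S Rᵐᵒᵖ M] (s : S) (m : M) (n : N) :
    s • tmul R m n = tmul R (s • m) n :=
  rfl

/-- If `N` is an `(R, T)`-bimodule, then `M ⊗ N` is a right `T`-module. -/
instance rightModule [Module Tᵐᵒᵖ N] [SMulCommClass R Tᵐᵒᵖ N] :
    Module Tᵐᵒᵖ (NCTensor R M N) where
  smul t := map LinearMap.id
    { toFun := fun n => t • n
      map_add' := smul_add t
      map_smul' := fun r n => (smul_comm r t n).symm }
  one_smul x := by
    change map _ _ x = x
    induction x using induction_on with
    | zero => simp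
    | tmul m n => simp
    | add x y hx hy => simp only [map_add, hx, hy]
  mul_smul s t x := by
    change map _ _ x = map _ _ (map _ _ x)
    induction x using induction_on with
    | zero => simp
    | tmul m n => simp [mul_smul]
    | add x y hx hy => simp only [map_add, hx, hy]
  smul_zero s := map_zero _
  smul_add s := map_add _
  add_smul s t x := by
    change map _ _ x = map _ _ x + map _ _ x
    induction x using induction_on with
    | zero => simp
    | tmul m n => simp [add_smul, tmul_add]
    | add x y hx hy => simp only [map_add, hx, hy]; abel
  zero_smul x := by
    change map _ _ x = 0
    induction x using induction_on with
    | zero => simp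
    | tmul m n => simp [tmul_zero]
    | add x y hx hy => simp only [map_add, hx, hy, add_zero]

theorem smul_def_right [Module Tᵐᵒᵖ N] [SMulCommClass R Tᵐᵒᵖ N] (t : Tᵐᵒᵖ) (m : M) (n : N) :
    t • tmul R m n = tmul R m (t • n) :=
  rfl

instance [Module S M] [SMulCommClass S Rᵐᵒᵖ M] [Module Tᵐᵒᵖ N] [SMulCommClass R Tᵐᵒᵖ N] :
    SMulCommClass S Tᵐᵒᵖ (NCTensor R M N) where
  smul_comm s t x := by
    induction x using induction_on with
    | zero => simp
    | tmul m n => rfl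
    | add x y hx hy => simp only [smul_add, hx, hy]

/-- `f ⊗ N` as a right `T`-linear map, for an `(R, T)`-bimodule `N`. -/
def rTensor (N : Type*) [AddCommGroup N] [Module R N] [Module Tᵐᵒᵖ N] [SMulCommClass R Tᵐᵒᵖ N]
    (f : M →ₗ[Rᵐᵒᵖ] M') : NCTensor R M N →ₗ[Tᵐᵒᵖ] NCTensor R M' N where
  toFun := map f LinearMap.id
  map_add' := map_add _
  map_smul' t x := by
    induction x using induction_on with
    | zero => simp
    | tmul m n => rfl
    | add x y hx hy => simp only [smul_add, map_add, hx, hy]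

end Actions

section Assoc

variable {R S M N P M' N' P' : Type*} [Ring R] [Ring S]
  [AddCommGroup M] [Module Rᵐᵒᵖ M]
  [AddCommGroup N] [Module R N] [Module Sᵐᵒᵖ N] [SMulCommClass R Sᵐᵒᵖ N]
  [AddCommGroup P] [Module S P]

/-- The biadditive map `(m ⊗ n, p) ↦ m ⊗ (n ⊗ p)`. -/
def assocAux : NCTensor R M N →+ P →+ NCTensor R M (NCTensor S N P) :=
  lift
    (AddMonoidHom.mk'
      (fun m => AddMonoidHom.mk'
        (fun n => AddMonoidHom.mk' (fun p => tmul R m (tmul S n p))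
          (fun a b => by rw [tmul_add, tmul_add]))
        (fun a b => AddMonoidHom.ext (fun p => by
          change tmul R m (tmul S (a + b) p) = tmul R m (tmul S a p) + tmul R m (tmul S b p)
          rw [add_tmul, tmul_add])))
      (fun a b => AddMonoidHom.ext (fun n => AddMonoidHom.ext (fun p => add_tmul a b _))))
    (fun m r n => AddMonoidHom.ext (fun p => smul_tmul r m (tmul S n p)))

/-- The canonical map `(M ⊗ N) ⊗ P → M ⊗ (N ⊗ P)`. -/
def assocHom : NCTensor S (NCTensor R M N) P →+ NCTensor R M (NCTensor S N P) :=
  lift assocAux (fun x s p => by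
    induction x using induction_on with
    | zero => rw [smul_zero, map_zero, AddMonoidHom.zero_apply, AddMonoidHom.zero_apply]
    | tmul m n => exact congrArg (tmul R m) (smul_tmul s n p)
    | add x y hx hy => simp only [smul_add, map_add, AddMonoidHom.add_apply, hx, hy])

/-- The biadditive map `(m, n ⊗ p) ↦ (m ⊗ n) ⊗ p`. -/
def assocInvAux : M →+ NCTensor S N P →+ NCTensor S (NCTensor R M N) P :=
  AddMonoidHom.mk'
    (fun m => lift
      (AddMonoidHom.mk'
        (fun n => AddMonoidHom.mk' (fun p => tmul S (tmul R m n) p) (tmul_add _))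
        (fun a b => AddMonoidHom.ext (fun p => by
          change tmul S (tmul R m (a + b)) p = tmul S (tmul R m a) p + tmul S (tmul R m b) p
          rw [tmul_add, add_tmul])))
      (fun n s p => smul_tmul s (tmul R m n) p))
    (fun a b => hom_ext (fun n p => by
      change tmul S (tmul R (a + b) n) p = tmul S (tmul R a n) p + tmul S (tmul R b n) p
      rw [add_tmul, add_tmul]))

/-- The canonical map `M ⊗ (N ⊗ P) → (M ⊗ N) ⊗ P`. -/
def assocInv : NCTensor R M (NCTensor S N P) →+ NCTensor S (NCTensor R M N) P :=
  lift assocInvAux (fun m r x => by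
    induction x using induction_on with
    | zero => rw [smul_zero, map_zero, map_zero]
    | tmul n p => exact congrArg (fun y => tmul S y p) (smul_tmul r m n)
    | add x y hx hy => simp only [smul_add, map_add, hx, hy])

@[simp]
theorem assocHom_tmul (m : M) (n : N) (p : P) :
    assocHom (tmul S (tmul R m n) p) = tmul R m (tmul S n p) :=
  rfl

@[simp]
theorem assocInv_tmul (m : M) (n : N) (p : P) :
    assocInv (tmul R m (tmul S n p)) = tmul S (tmul R m n) p :=
  rfl

theorem assoc_ext {Q : Type*} [AddCommGroup Q] {f g : NCTensor S (NCTensor R M N) P →+ Q}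
    (h : ∀ m n p, f (tmul S (tmul R m n) p) = g (tmul S (tmul R m n) p)) : f = g := by
  refine hom_ext (fun x p => ?_)
  induction x using induction_on with
  | zero => rw [zero_tmul, map_zero, map_zero]
  | tmul m n => exact h m n p
  | add x y hx hy => simp only [add_tmul, map_add, hx, hy]

theorem assoc_ext' {Q : Type*} [AddCommGroup Q] {f g : NCTensor R M (NCTensor S N P) →+ Q}
    (h : ∀ m n p, f (tmul R m (tmul S n p)) = g (tmul R m (tmul S n p))) : f = g := by
  refine hom_ext (fun m x => ?_)
  induction x using induction_on with
  | zero => rw [tmul_zero, map_zero, map_zero]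
  | tmul n p => exact h m n p
  | add x y hx hy => simp only [tmul_add, map_add, hx, hy]

variable (R S M N P) in
/-- The associativity isomorphism `(M ⊗ N) ⊗ P ≃ M ⊗ (N ⊗ P)`. -/
def assoc : NCTensor S (NCTensor R M N) P ≃+ NCTensor R M (NCTensor S N P) where
  toFun := assocHom
  invFun := assocInv
  left_inv x := DFunLike.congr_fun
    (assoc_ext (f := assocInv.comp assocHom)
      (g := AddMonoidHom.id (NCTensor S (NCTensor R M N) P)) (fun _ _ _ => rfl)) x
  right_inv x := DFunLike.congr_fun
    (assoc_ext' (f := assocHom.comp assocInv)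
      (g := AddMonoidHom.id (NCTensor R M (NCTensor S N P))) (fun _ _ _ => rfl)) x
  map_add' := map_add _

@[simp]
theorem assoc_tmul (m : M) (n : N) (p : P) :
    assoc R S M N P (tmul S (tmul R m n) p) = tmul R m (tmul S n p) :=
  rfl

@[simp]
theorem assoc_symm_tmul (m : M) (n : N) (p : P) :
    (assoc R S M N P).symm (tmul R m (tmul S n p)) = tmul S (tmul R m n) p :=
  rfl

theorem assoc_map {M' : Type*} [AddCommGroup M'] [Module Rᵐᵒᵖ M'] (f : M →ₗ[Rᵐᵒᵖ] M')
    (x : NCTensor S (NCTensor R M N) P) :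
    assoc R S M' N P (map (rTensor N f) LinearMap.id x) =
      map f LinearMap.id (assoc R S M N P x) :=
  DFunLike.congr_fun (assoc_ext
    (f := (assoc R S M' N P).toAddMonoidHom.comp (map (rTensor N f) LinearMap.id))
    (g := (map f LinearMap.id).comp (assoc R S M N P).toAddMonoidHom) (fun _ _ _ => rfl)) x

end Assoc

/-- A left `B`-module `Q` is faithfully flat if a sequence of right `B`-modules is exact
if and only if its tensor product with `Q` is exact. -/
def FaithfullyFlat (B Q : Type u) [Ring B] [AddCommGroup Q] [Module B Q] : Prop :=
  ∀ (X Y Z : Type u) [AddCommGroup X] [AddCommGroup Y] [AddCommGroup Z]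
    [Module Bᵐᵒᵖ X] [Module Bᵐᵒᵖ Y] [Module Bᵐᵒᵖ Z]
    (f : X →ₗ[Bᵐᵒᵖ] Y) (g : Y →ₗ[Bᵐᵒᵖ] Z),
    Function.Exact f g ↔
      Function.Exact (map f (LinearMap.id : Q →ₗ[B] Q)) (map g (LinearMap.id : Q →ₗ[B] Q))

end NCTensor

open NCTensor

/-! ### Corings and comodules -/

/-- Homomorphisms of `(R, S)`-bimodules. -/
structure BimodHom (R S M N : Type*) [Ring R] [Ring S] [AddCommGroup M] [Module R M]
    [Module Sᵐᵒᵖ M] [AddCommGroup N] [Module R N] [Module Sᵐᵒᵖ N] where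
  /-- The underlying left linear map. -/
  left : M →ₗ[R] N
  map_op_smul : ∀ (s : Sᵐᵒᵖ) (m : M), left (s • m) = s • left m

/-- The underlying right linear map of a bimodule homomorphism. -/
def BimodHom.right {R S M N : Type*} [Ring R] [Ring S] [AddCommGroup M] [Module R M]
    [Module Sᵐᵒᵖ M] [AddCommGroup N] [Module R N] [Module Sᵐᵒᵖ N] (f : BimodHom R S M N) :
    M →ₗ[Sᵐᵒᵖ] N where
  toFun := f.left
  map_add' := map_add f.left
  map_smul' := f.map_op_smul

/-- An `A`-coring: an `A`-bimodule `C` with a coassociative and counital bimodule coproduct. -/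
class Coring (A C : Type*) [Ring A] [AddCommGroup C] [Module A C] [Module Aᵐᵒᵖ C]
    [SMulCommClass A Aᵐᵒᵖ C] where
  /-- The coproduct. -/
  comul : BimodHom A A C (NCTensor A C C)
  /-- The counit. -/
  counit : BimodHom A A C A
  coassoc : ∀ c : C, assoc A A C C C (map comul.right LinearMap.id (comul.left c)) =
    map LinearMap.id comul.left (comul.left c)
  counit_left : ∀ c : C, lid (map counit.right LinearMap.id (comul.left c)) = c
  counit_right : ∀ c : C, rid (map LinearMap.id counit.left (comul.left c)) = c

/-- The right `C`-coactions on the right `A`-module `M`. This type is also the set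
`Z¹(C, M)` of descent `1`-cocycles. -/
@[ext]
structure Coaction (A C M : Type*) [Ring A] [AddCommGroup C] [Module A C] [Module Aᵐᵒᵖ C]
    [SMulCommClass A Aᵐᵒᵖ C] [Coring A C] [AddCommGroup M] [Module Aᵐᵒᵖ M] where
  /-- The coaction as a right `A`-linear map. -/
  toLin : M →ₗ[Aᵐᵒᵖ] NCTensor A M C
  coassoc : ∀ m : M, assoc A A M C C (map toLin LinearMap.id (toLin m)) =
    map LinearMap.id (Coring.comul (A := A) (C := C)).left (toLin m)
  counit : ∀ m : M, rid (map LinearMap.id (Coring.counit (A := A) (C := C)).left (toLin m)) = m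

namespace Coaction

section Comodules

variable {A C M X Y : Type*} [Ring A] [AddCommGroup C] [Module A C] [Module Aᵐᵒᵖ C]
  [SMulCommClass A Aᵐᵒᵖ C] [Coring A C]
  [AddCommGroup M] [Module Aᵐᵒᵖ M] [AddCommGroup X] [Module Aᵐᵒᵖ X]
  [AddCommGroup Y] [Module Aᵐᵒᵖ Y]

variable (A C) in
/-- `C` as a right comodule over itself. -/
def regular : Coaction A C C where
  toLin := (Coring.comul (A := A) (C := C)).right
  coassoc := Coring.coassoc
  counit := Coring.counit_right

/-- The condition `ρ^Y ∘ f = (f ⊗ C) ∘ ρ^X`. -/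
def IsColinear (ρX : Coaction A C X) (ρY : Coaction A C Y) (f : X →ₗ[Aᵐᵒᵖ] Y) : Prop :=
  ∀ x, ρY.toLin (f x) = map f LinearMap.id (ρX.toLin x)

/-- The group `Hom^C(X, Y)` of homomorphisms of right `C`-comodules. -/
def hom (ρX : Coaction A C X) (ρY : Coaction A C Y) : AddSubgroup (X →ₗ[Aᵐᵒᵖ] Y) where
  carrier := {f | IsColinear ρX ρY f}
  zero_mem' x := by
    have h : map (0 : X →ₗ[Aᵐᵒᵖ] Y) (LinearMap.id : C →ₗ[A] C) = 0 := hom_ext (fun m n => by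
      simp [zero_tmul])
    simp [h]
  add_mem' {f g} hf hg x := by
    have h : map (f + g) (LinearMap.id : C →ₗ[A] C)
        = map f LinearMap.id + map g LinearMap.id := hom_ext (fun m n => by simp [add_tmul])
    simp [h, hf x, hg x]
  neg_mem' {f} hf x := by
    have h : map (-f) (LinearMap.id : C →ₗ[A] C) = - map f LinearMap.id := hom_ext (fun m n => by
      rw [AddMonoidHom.neg_apply, eq_neg_iff_add_eq_zero, map_tmul, map_tmul, ← add_tmul]
      simp [zero_tmul])
    simp [h, hf x]

/-- The ring `End^C(X)` of endomorphisms of a right `C`-comodule, with composition. -/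
def endRing (ρ : Coaction A C X) : Subring (Module.End Aᵐᵒᵖ X) where
  carrier := {f | IsColinear ρ ρ f}
  mul_mem' {f g} hf hg x := by
    rw [Module.End.mul_apply, hf, hg, map_map]
    rfl
  one_mem' x := (map_id_id _).symm
  add_mem' hf hg := (hom ρ ρ).add_mem hf hg
  zero_mem' := (hom ρ ρ).zero_mem
  neg_mem' hf := (hom ρ ρ).neg_mem hf

/-- `Hom^C(X, Y)` is a right `End^C(X)`-module by composition. -/
instance homModule (ρX : Coaction A C X) (ρY : Coaction A C Y) :
    Module (endRing ρX)ᵐᵒᵖ (hom ρX ρY) where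
  smul b f := ⟨f.1 ∘ₗ (unop b).1, fun x => by
    rw [LinearMap.comp_apply, f.2, (unop b).2, map_map]
    rfl⟩
  one_smul f := rfl
  mul_smul b c f := rfl
  smul_zero b := rfl
  smul_add b f g := rfl
  add_smul b c f := Subtype.ext (LinearMap.ext (fun x => map_add f.1 _ _))
  zero_smul f := Subtype.ext (LinearMap.ext (fun x => map_zero f.1))

/-- The map `N ⊗ ρ : N ⊗_B Q → (N ⊗_B Q) ⊗_A C`, for a `(B, A)`-bimodule `Q` with a left
`B`-linear and right `A`-linear map `ρ : Q → Q ⊗_A C`. -/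
def inducedLin {B Q : Type*} [Ring B] [AddCommGroup Q] [Module B Q] [Module Aᵐᵒᵖ Q]
    [SMulCommClass B Aᵐᵒᵖ Q] (ρ : Q →ₗ[Aᵐᵒᵖ] NCTensor A Q C)
    (hρ : ∀ (b : B) (q : Q), ρ (b • q) = b • ρ q)
    (N : Type*) [AddCommGroup N] [Module Bᵐᵒᵖ N] :
    NCTensor B N Q →ₗ[Aᵐᵒᵖ] NCTensor A (NCTensor B N Q) C where
  toFun x := (assoc B A N Q C).symm
    (map LinearMap.id { toFun := ρ, map_add' := map_add ρ, map_smul' := hρ } x)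
  map_add' x y := by simp only [map_add]
  map_smul' a x := by
    have key : ∀ y : NCTensor B N (NCTensor A Q C),
        (assoc B A N Q C).symm (a • y) = a • (assoc B A N Q C).symm y := by
      intro y
      induction y using NCTensor.induction_on with
      | zero => simp only [smul_zero, map_zero]
      | tmul n z =>
        rw [smul_def_right]
        induction z using NCTensor.induction_on with
        | zero => simp only [smul_zero, tmul_zero, map_zero]
        | tmul q c => rfl
        | add x y hx hy => simp only [smul_add, tmul_add, map_add, hx, hy]
      | add x y hx hy => simp only [smul_add, map_add, hx, hy]
    rw [RingHom.id_apply, ← key]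
    congr 1
    induction x using NCTensor.induction_on with
    | zero => simp only [smul_zero, map_zero]
    | tmul n q => exact congrArg (tmul B n) (ρ.map_smul a q)
    | add x y hx hy => simp only [smul_add, map_add, hx, hy]

/-- For a `(B, A)`-bimodule `Q` with left `B`-linear right coaction `ρ`, the induced coaction
`N ⊗ ρ` on `N ⊗_B Q`. -/
def induced {B Q : Type*} [Ring B] [AddCommGroup Q] [Module B Q] [Module Aᵐᵒᵖ Q]
    [SMulCommClass B Aᵐᵒᵖ Q] (ρ : Coaction A C Q)
    (hρ : ∀ (b : B) (q : Q), ρ.toLin (b • q) = b • ρ.toLin q)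
    (N : Type*) [AddCommGroup N] [Module Bᵐᵒᵖ N] : Coaction A C (NCTensor B N Q) where
  toLin := inducedLin ρ.toLin hρ N
  coassoc x := by
    induction x using NCTensor.induction_on with
    | zero => simp only [map_zero]
    | add x y hx hy => simp only [map_add, hx, hy]
    | tmul n q =>
      -- `n ⊗ -` as a right linear map `Q → N ⊗ Q`
      let j : Q →ₗ[Aᵐᵒᵖ] NCTensor B N Q :=
        { toFun := fun q => tmul B n q, map_add' := tmul_add n, map_smul' := fun _ _ => rfl }
      have hj : ∀ q, inducedLin ρ.toLin hρ N (j q) = map j LinearMap.id (ρ.toLin q) := by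
        intro q
        change (assoc B A N Q C).symm (tmul B n (ρ.toLin q)) = _
        induction ρ.toLin q using NCTensor.induction_on with
        | zero => simp only [tmul_zero, map_zero]
        | tmul q c => rfl
        | add x y hx hy => simp only [tmul_add, map_add, hx, hy]
      have hj' : inducedLin ρ.toLin hρ N ∘ₗ j = rTensor C j ∘ₗ ρ.toLin := LinearMap.ext hj
      change assoc A A _ C C (map _ _ (inducedLin ρ.toLin hρ N (j q))) =
        map _ _ (inducedLin ρ.toLin hρ N (j q))
      rw [hj, map_map, hj']
      have h1 : map (rTensor C j ∘ₗ ρ.toLin) (LinearMap.id ∘ₗ LinearMap.id) (ρ.toLin q)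
          = map (rTensor C j) (LinearMap.id : C →ₗ[A] C)
              (map ρ.toLin LinearMap.id (ρ.toLin q)) := (map_map _ _ _ _ _).symm
      rw [h1, assoc_map, ρ.coassoc, map_map, map_map]
      rfl
  counit x := by
    induction x using NCTensor.induction_on with
    | zero => simp only [map_zero]
    | add x y hx hy => simp only [map_add, hx, hy]
    | tmul n q =>
      conv_rhs => rw [← ρ.counit q]
      change rid (map _ _ ((assoc B A N Q C).symm (tmul B n (ρ.toLin q)))) = _
      induction ρ.toLin q using NCTensor.induction_on with
      | zero => simp only [tmul_zero, map_zero]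
      | tmul q c => rfl
      | add x y hx hy => simp only [tmul_add, map_add, hx, hy]

/-- The coaction of a comodule is left linear over its endomorphism ring. -/
theorem toLin_end_smul (ρ : Coaction A C X) (b : endRing ρ) (x : X) :
    ρ.toLin (b • x) = b • ρ.toLin x :=
  b.2 x

/-- The pulled back coaction `f^*(F) = (f⁻¹ ⊗ C) ∘ F ∘ f` along a right `A`-linear isomorphism. -/
def pullback (f : X ≃ₗ[Aᵐᵒᵖ] Y) (F : Coaction A C Y) : Coaction A C X where
  toLin := rTensor C f.symm.toLinearMap ∘ₗ F.toLin ∘ₗ f.toLinearMap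
  coassoc x := by
    have h1 : (rTensor C f.symm.toLinearMap ∘ₗ F.toLin ∘ₗ f.toLinearMap) ∘ₗ f.symm.toLinearMap
        = rTensor C f.symm.toLinearMap ∘ₗ F.toLin := by
      ext y
      simp
    change assoc A A _ C C (map _ _ (map f.symm.toLinearMap LinearMap.id (F.toLin (f x)))) =
      map _ _ (map f.symm.toLinearMap LinearMap.id (F.toLin (f x)))
    rw [map_map, h1]
    have h2 : map (rTensor C f.symm.toLinearMap ∘ₗ F.toLin) (LinearMap.id ∘ₗ LinearMap.id)
          (F.toLin (f x))
        = map (rTensor C f.symm.toLinearMap) (LinearMap.id : C →ₗ[A] C)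
            (map F.toLin LinearMap.id (F.toLin (f x))) := (map_map _ _ _ _ _).symm
    rw [h2, assoc_map, F.coassoc, map_map, map_map]
    rfl
  counit x := by
    have h : ∀ z : NCTensor A Y C,
        rid (map LinearMap.id (Coring.counit (A := A) (C := C)).left
          (map f.symm.toLinearMap LinearMap.id z)) =
        f.symm (rid (map LinearMap.id (Coring.counit (A := A) (C := C)).left z)) := by
      intro z
      induction z using NCTensor.induction_on with
      | zero => simp only [map_zero]
      | tmul y c => exact (f.symm.map_smul _ y).symm
      | add x y hx hy => simp only [map_add, hx, hy]
    refine (h (F.toLin (f x))).trans ?_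
    rw [F.counit, LinearEquiv.symm_apply_apply]

/-- The right action `(F, f) ↦ f^*(F)` of `Aut_A(M)` on `Z¹(C, M)`. -/
instance autAction : MulAction (M ≃ₗ[Aᵐᵒᵖ] M)ᵐᵒᵖ (Coaction A C M) where
  smul f F := pullback (unop f) F
  one_smul F := by
    ext x
    exact map_id_id _
  mul_smul f g F := by
    ext x
    change map _ _ _ = map _ _ (map _ _ _)
    rw [map_map]
    rfl

end Comodules

end Coaction

open Coaction

/-- The first descent cohomology set `D¹(C, M)`. -/
def DescentD1 (A C M : Type*) [Ring A] [AddCommGroup C] [Module A C] [Module Aᵐᵒᵖ C]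
    [SMulCommClass A Aᵐᵒᵖ C] [Coring A C] [AddCommGroup M] [Module Aᵐᵒᵖ M] : Type _ :=
  MulAction.orbitRel.Quotient (M ≃ₗ[Aᵐᵒᵖ] M)ᵐᵒᵖ (Coaction A C M)

/-- The class in `D¹(C, M)` of a coaction. The class of the given coaction of a comodule `M` is
the distinguished point. -/
def DescentD1.mk {A C M : Type*} [Ring A] [AddCommGroup C] [Module A C] [Module Aᵐᵒᵖ C]
    [SMulCommClass A Aᵐᵒᵖ C] [Coring A C] [AddCommGroup M] [Module Aᵐᵒᵖ M]
    (F : Coaction A C M) : DescentD1 A C M :=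
  Quotient.mk (MulAction.orbitRel (M ≃ₗ[Aᵐᵒᵖ] M)ᵐᵒᵖ (Coaction A C M)) F

/-! ### Twisted forms -/

/-- A `Q`-twisted form of `N`, for a `(B, A)`-bimodule `Q` and a right `B`-module `N`: a right
`B`-module `P` with a right `A`-linear isomorphism `P ⊗_B Q ≃ N ⊗_B Q`. -/
structure TwistedForm (A B Q N : Type u) [Ring A] [Ring B] [AddCommGroup Q] [Module B Q]
    [Module Aᵐᵒᵖ Q] [SMulCommClass B Aᵐᵒᵖ Q] [AddCommGroup N] [Module Bᵐᵒᵖ N] where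
  /-- The underlying right module. -/
  carrier : Type u
  [addCommGroup : AddCommGroup carrier]
  [module : Module Bᵐᵒᵖ carrier]
  /-- The right `A`-linear isomorphism. -/
  iso : NCTensor B carrier Q ≃ₗ[Aᵐᵒᵖ] NCTensor B N Q

attribute [instance] TwistedForm.addCommGroup TwistedForm.module

section Twist

variable (A B Q N : Type u) [Ring A] [Ring B] [AddCommGroup Q] [Module B Q]
    [Module Aᵐᵒᵖ Q] [SMulCommClass B Aᵐᵒᵖ Q] [AddCommGroup N] [Module Bᵐᵒᵖ N]

/-- Twisted forms are equivalent if the underlying right `B`-modules are isomorphic. -/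
def TwistedForm.setoid : Setoid (TwistedForm A B Q N) where
  r P P' := Nonempty (P.carrier ≃ₗ[Bᵐᵒᵖ] P'.carrier)
  iseqv :=
    { refl := fun _ => ⟨LinearEquiv.refl _ _⟩
      symm := fun ⟨e⟩ => ⟨e.symm⟩
      trans := fun ⟨e⟩ ⟨e'⟩ => ⟨e.trans e'⟩ }

/-- The set of equivalence classes of `Q`-twisted forms of `N`. -/
def Twist : Type (u + 1) :=
  Quotient (TwistedForm.setoid A B Q N)

/-- The distinguished point of `Twist`: the class of `N` with the identity map. -/
def Twist.point : Twist A B Q N :=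
  Quotient.mk (TwistedForm.setoid A B Q N) ⟨N, LinearEquiv.refl _ _⟩

end Twist

/-! ### Galois comodules -/

namespace Coaction

variable {A C Q : Type*} [Ring A] [AddCommGroup C] [Module A C] [Module Aᵐᵒᵖ C]
  [SMulCommClass A Aᵐᵒᵖ C] [Coring A C] [AddCommGroup Q] [Module Aᵐᵒᵖ Q]

/-- The comodule structure `N ⊗_B ρ` on `N ⊗_B Q`, where `B = End^C(Q)`. -/
def tensorCoaction (ρ : Coaction A C Q) (N : Type*) [AddCommGroup N]
    [Module (endRing ρ)ᵐᵒᵖ N] : Coaction A C (NCTensor (endRing ρ) N Q) :=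
  induced ρ (toLin_end_smul ρ) N

/-- The evaluation map `Hom^C(Q, C) ⊗_B Q → C`, where `B = End^C(Q)`. -/
def evaluation (ρ : Coaction A C Q) :
    NCTensor (endRing ρ) (hom ρ (regular A C)) Q →ₗ[Aᵐᵒᵖ] C where
  toFun := lift
    (AddMonoidHom.mk' (fun f => f.1.toAddMonoidHom) (fun f g => rfl))
    (fun f b q => rfl)
  map_add' := map_add _
  map_smul' a x := by
    induction x using NCTensor.induction_on with
    | zero => simp
    | tmul f q => exact f.1.map_smul a q
    | add x y hx hy => simp only [smul_add, map_add, hx, hy]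

/-- `Q` is a Galois comodule: it is finitely generated and projective as a right `A`-module, and
the evaluation map is an isomorphism of right `C`-comodules. -/
structure IsGalois (ρ : Coaction A C Q) : Prop where
  finite : Module.Finite Aᵐᵒᵖ Q
  projective : Module.Projective Aᵐᵒᵖ Q
  colinear : IsColinear (tensorCoaction ρ (hom ρ (regular A C))) (regular A C) (evaluation ρ)
  bijective : Function.Bijective (evaluation ρ)

end Coaction

end

open NCTensor Coaction

noncomputable section

/-! Write `B = End^C(S)`. The theorem follows once `P ↦ P ⊗_B S` and `X ↦ Hom^C(S, X)` are known to
be mutually inverse between right `B`-modules and right `C`-comodules. A coaction `F` on `N ⊗_B S`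
then yields the module `Hom^C(S, (N ⊗_B S, F))` with the evaluation isomorphism as twisting datum. A
twisted form `(P, φ)` conversely yields the coaction of `P ⊗_B S` transported along `φ`. Isomorphic
modules correspond to coactions related by a colinear automorphism, that is, to one orbit.

The counit of the equivalence is `homEval_bijective`. The module `Hom^C(S, X)` is the kernel of the
difference of two maps `Hom_A(S, X) → Hom_A(S, X ⊗ C)`, and flatness preserves this exactness after
`- ⊗_B S`. The map `cofreeEval : Hom_A(S, X) ⊗_B S → X ⊗_A C` turns the tensored maps into `F ⊗ C`
and `X ⊗ Δ`, whose equalizer is the image of `X` under `F`. That `cofreeEval` is bijective combines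
the dual basis of `S`, the identification `Hom_A(S, A) ≃ Hom^C(S, C)` and the Galois isomorphism.

The unit is `homUnit_bijective`: it becomes bijective after tensoring with `S`, hence is bijective
by faithful flatness. -/

namespace NCTensor

/-! ### Injectivity and surjectivity under a faithfully flat tensor product -/

section Flat

variable {B Q X Y : Type u} [Ring B] [AddCommGroup Q] [Module B Q]
  [AddCommGroup X] [AddCommGroup Y] [Module Bᵐᵒᵖ X] [Module Bᵐᵒᵖ Y]

/-- Injectivity is exactness of `0 → X → Y`, and the zero map stays zero after tensoring. -/
theorem FaithfullyFlat.injective_iff (h : FaithfullyFlat B Q) (f : X →ₗ[Bᵐᵒᵖ] Y) :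
    Function.Injective (map f (LinearMap.id : Q →ₗ[B] Q)) ↔ Function.Injective f := by
  have h0 := h PUnit X Y (0 : PUnit.{u + 1} →ₗ[Bᵐᵒᵖ] X) f
  have hz : ∀ x, map (0 : PUnit.{u + 1} →ₗ[Bᵐᵒᵖ] X) (LinearMap.id : Q →ₗ[B] Q) x = 0 := by
    intro x
    induction x using induction_on with
    | zero => simp
    | tmul m n => simp [zero_tmul]
    | add x y hx hy => simp only [map_add, hx, hy, add_zero]
  rw [injective_iff_map_eq_zero, injective_iff_map_eq_zero]
  constructor
  · intro hf
    have := h0.2 (fun y => ⟨fun hy => ⟨0, by rw [map_zero, hf y hy]⟩, fun ⟨x, hx⟩ => by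
      rw [← hx, hz, map_zero]⟩)
    intro y hy
    obtain ⟨x, hx⟩ := (this y).1 hy
    exact hx.symm
  · intro hf
    have := h0.1 (fun y => ⟨fun hy => ⟨0, by rw [map_zero, hf y hy]⟩, fun ⟨x, hx⟩ => by
      rw [← hx, LinearMap.zero_apply, map_zero]⟩)
    intro y hy
    obtain ⟨x, hx⟩ := (this y).1 hy
    rw [← hx, hz]

/-- Surjectivity is exactness of `X → Y → 0`, which the tensor product reflects. -/
theorem FaithfullyFlat.surjective_of_map (h : FaithfullyFlat B Q) (f : X →ₗ[Bᵐᵒᵖ] Y)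
    (hf : Function.Surjective (map f (LinearMap.id : Q →ₗ[B] Q))) : Function.Surjective f := by
  have hz : ∀ x, map (0 : Y →ₗ[Bᵐᵒᵖ] PUnit.{u + 1}) (LinearMap.id : Q →ₗ[B] Q) x = 0 := by
    intro x
    induction x using induction_on with
    | zero => simp
    | tmul m n => exact zero_tmul n
    | add x y hx hy => simp only [map_add, hx, hy, add_zero]
  have := (h X Y PUnit f (0 : Y →ₗ[Bᵐᵒᵖ] PUnit.{u + 1})).2 (fun y => ⟨fun _ => hf y, fun _ => hz y⟩)
  exact fun y => (this y).1 rfl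

end Flat

theorem map_add_id {R M M' N : Type*} [Ring R] [AddCommGroup M] [Module Rᵐᵒᵖ M]
    [AddCommGroup M'] [Module Rᵐᵒᵖ M'] [AddCommGroup N] [Module R N]
    (f g : M →ₗ[Rᵐᵒᵖ] M') (x : NCTensor R M N) :
    map (f + g) (LinearMap.id : N →ₗ[R] N) x = map f LinearMap.id x + map g LinearMap.id x := by
  rw [← AddMonoidHom.add_apply]
  exact DFunLike.congr_fun (hom_ext (fun m n => by simp [add_tmul])) x

section Equiv

variable {R T M M' N : Type*} [Ring R] [Ring T]
  [AddCommGroup M] [Module Rᵐᵒᵖ M] [AddCommGroup M'] [Module Rᵐᵒᵖ M']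
  [AddCommGroup N] [Module R N] [Module Tᵐᵒᵖ N] [SMulCommClass R Tᵐᵒᵖ N]

variable (N) in
theorem map_map_symm (e : M ≃ₗ[Rᵐᵒᵖ] M') (x : NCTensor R M' N) :
    map e.toLinearMap (LinearMap.id : N →ₗ[R] N)
      (map e.symm.toLinearMap (LinearMap.id : N →ₗ[R] N) x) = x := by
  rw [map_map, LinearMap.id_comp, LinearEquiv.comp_symm]
  exact map_id_id x

variable (T N) in
/-- `e ⊗ N` as a right linear isomorphism. -/
def rTensorEquiv (e : M ≃ₗ[Rᵐᵒᵖ] M') : NCTensor R M N ≃ₗ[Tᵐᵒᵖ] NCTensor R M' N :=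
  { rTensor (T := T) N e.toLinearMap with
    invFun := rTensor (T := T) N e.symm.toLinearMap
    left_inv := map_map_symm N e.symm
    right_inv := map_map_symm N e }

end Equiv

end NCTensor

namespace Coaction

/-! ### Colinear maps, the unit and counit, and the comparison map `cofreeEval` -/

section Hom

variable {A C S X Y : Type*} [Ring A] [AddCommGroup C] [Module A C] [Module Aᵐᵒᵖ C]
  [SMulCommClass A Aᵐᵒᵖ C] [Coring A C] [AddCommGroup S] [Module Aᵐᵒᵖ S]
  [AddCommGroup X] [Module Aᵐᵒᵖ X] [AddCommGroup Y] [Module Aᵐᵒᵖ Y]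

theorem toLin_injective (F : Coaction A C X) : Function.Injective F.toLin := fun x y h => by
  rw [← F.counit x, h, F.counit]

theorem IsColinear.symm {F : Coaction A C X} {G : Coaction A C Y} {f : X ≃ₗ[Aᵐᵒᵖ] Y}
    (hf : IsColinear F G f.toLinearMap) : IsColinear G F f.symm.toLinearMap := fun y => by
  have h := hf (f.symm y)
  rw [LinearEquiv.coe_coe, LinearEquiv.apply_symm_apply] at h
  rw [h]
  exact (map_map_symm C f.symm _).symm

theorem IsColinear.comp {Z : Type*} [AddCommGroup Z] [Module Aᵐᵒᵖ Z]
    {F : Coaction A C X} {G : Coaction A C Y} {H : Coaction A C Z}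
    {g : Y →ₗ[Aᵐᵒᵖ] Z} {f : X →ₗ[Aᵐᵒᵖ] Y}
    (hg : IsColinear G H g) (hf : IsColinear F G f) : IsColinear F H (g ∘ₗ f) := fun x => by
  rw [LinearMap.comp_apply, hg, hf, map_map]
  rfl

theorem isColinear_pullback (f : X ≃ₗ[Aᵐᵒᵖ] Y) (G : Coaction A C Y) :
    IsColinear (pullback f G) G f.toLinearMap := fun _ => (map_map_symm C f _).symm

/-- Together with `isColinear_pullback`, this translates the orbit relation on coactions into the
existence of a colinear automorphism. -/
theorem IsColinear.pullback_eq {F : Coaction A C X} {G : Coaction A C Y} {f : X ≃ₗ[Aᵐᵒᵖ] Y}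
    (hf : IsColinear F G f.toLinearMap) : pullback f G = F := by
  ext x
  change map _ _ (G.toLin (f.toLinearMap x)) = _
  rw [hf]
  exact map_map_symm C f.symm _

/-- A comodule isomorphism `X ≃ Y` induces `Hom^C(S, X) ≃ Hom^C(S, Y)`. -/
def homCongr (ρ : Coaction A C S) {F : Coaction A C X} {G : Coaction A C Y}
    (f : X ≃ₗ[Aᵐᵒᵖ] Y) (hf : IsColinear F G f.toLinearMap) :
    hom ρ F ≃ₗ[(endRing ρ)ᵐᵒᵖ] hom ρ G where
  toFun g := ⟨f.toLinearMap ∘ₗ g.1, hf.comp g.2⟩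
  invFun g := ⟨f.symm.toLinearMap ∘ₗ g.1, hf.symm.comp g.2⟩
  left_inv g := by ext; simp
  right_inv g := by ext; simp
  map_add' g h := by ext; simp
  map_smul' b g := rfl

/-- `Hom_A(S, X)` is a right module over `End^C(S)` by composition. -/
instance linHomModule (ρ : Coaction A C S) : Module (endRing ρ)ᵐᵒᵖ (S →ₗ[Aᵐᵒᵖ] X) where
  smul b f := f ∘ₗ (unop b).1
  one_smul _ := rfl
  mul_smul _ _ _ := rfl
  smul_zero _ := rfl
  smul_add _ _ _ := rfl
  add_smul _ _ f := LinearMap.ext fun _ => map_add f _ _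
  zero_smul f := LinearMap.ext fun _ => map_zero f

/-- Composition with `f : X → Y` as a map `Hom_A(S, X) → Hom_A(S, Y)` of right
`End^C(S)`-modules. -/
def postcomp (ρ : Coaction A C S) (f : X →ₗ[Aᵐᵒᵖ] Y) :
    (S →ₗ[Aᵐᵒᵖ] X) →ₗ[(endRing ρ)ᵐᵒᵖ] (S →ₗ[Aᵐᵒᵖ] Y) where
  toFun g := f ∘ₗ g
  map_add' g h := LinearMap.comp_add g h f
  map_smul' _ _ := rfl

/-- The inclusion `Hom^C(S, X) → Hom_A(S, X)`. -/
def homIncl (ρ : Coaction A C S) (F : Coaction A C X) :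
    hom ρ F →ₗ[(endRing ρ)ᵐᵒᵖ] (S →ₗ[Aᵐᵒᵖ] X) where
  toFun g := g.1
  map_add' _ _ := rfl
  map_smul' _ _ := rfl

/-- The map `Hom_A(S, X) → Hom_A(S, X ⊗ C)`, `f ↦ (f ⊗ C) ∘ ρ`. -/
def cofree (ρ : Coaction A C S) (X : Type*) [AddCommGroup X] [Module Aᵐᵒᵖ X] :
    (S →ₗ[Aᵐᵒᵖ] X) →ₗ[(endRing ρ)ᵐᵒᵖ] (S →ₗ[Aᵐᵒᵖ] NCTensor A X C) where
  toFun f := rTensor C f ∘ₗ ρ.toLin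
  map_add' f g := LinearMap.ext fun s => map_add_id f g (ρ.toLin s)
  map_smul' b f := LinearMap.ext fun s => by
    change map (f ∘ₗ (unop b).1) (LinearMap.id ∘ₗ LinearMap.id) (ρ.toLin s)
      = map f LinearMap.id (ρ.toLin ((unop b).1 s))
    rw [(unop b).2 s, map_map]

theorem cofree_apply (ρ : Coaction A C S) (f : S →ₗ[Aᵐᵒᵖ] X) (s : S) :
    cofree ρ X f s = map f LinearMap.id (ρ.toLin s) := rfl

/-- The map `Hom_A(S, X) ⊗_B S → X ⊗_A C`, `f ⊗ s ↦ (f ⊗ C) (ρ s)`, where `B = End^C(S)`. -/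
def cofreeEval (ρ : Coaction A C S) (X : Type*) [AddCommGroup X] [Module Aᵐᵒᵖ X] :
    NCTensor (endRing ρ) (S →ₗ[Aᵐᵒᵖ] X) S →+ NCTensor A X C :=
  lift
    (AddMonoidHom.mk' (fun f => (cofree ρ X f).toAddMonoidHom)
      (fun f g => by rw [map_add]; rfl))
    (fun f b s => by
      change cofree ρ X (op b • f) s = cofree ρ X f (b • s)
      rw [map_smul]; rfl)

theorem cofreeEval_tmul (ρ : Coaction A C S) (f : S →ₗ[Aᵐᵒᵖ] X) (s : S) :
    cofreeEval ρ X (tmul (endRing ρ) f s) = map f LinearMap.id (ρ.toLin s) := rfl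

theorem cofreeEval_postcomp (ρ : Coaction A C S) (f : X →ₗ[Aᵐᵒᵖ] Y)
    (t : NCTensor (endRing ρ) (S →ₗ[Aᵐᵒᵖ] X) S) :
    cofreeEval ρ Y (map (postcomp ρ f) LinearMap.id t)
      = map f LinearMap.id (cofreeEval ρ X t) := by
  induction t using NCTensor.induction_on with
  | zero => simp only [map_zero]
  | tmul g s =>
    rw [map_tmul, cofreeEval_tmul, cofreeEval_tmul, map_map]
    rfl
  | add x y hx hy => simp only [map_add, hx, hy]

/-- On `g ⊗ s` this is coassociativity of `ρ` with `g` applied to the first tensor factor. With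
`cofreeEval_postcomp` it identifies the two parallel maps of the kernel sequence after tensoring
with `S`. -/
theorem cofreeEval_cofree (ρ : Coaction A C S)
    (t : NCTensor (endRing ρ) (S →ₗ[Aᵐᵒᵖ] X) S) :
    assoc A A X C C (cofreeEval ρ (NCTensor A X C) (map (cofree ρ X) LinearMap.id t))
      = map LinearMap.id (Coring.comul (A := A) (C := C)).left (cofreeEval ρ X t) := by
  induction t using NCTensor.induction_on with
  | zero => simp only [map_zero]
  | tmul g s =>
    rw [map_tmul, cofreeEval_tmul, cofreeEval_tmul]
    have h1 : map (cofree ρ X g) LinearMap.id (ρ.toLin s)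
        = map (rTensor C g) (LinearMap.id : C →ₗ[A] C)
          (map ρ.toLin LinearMap.id (ρ.toLin s)) := by
      rw [map_map]
      rfl
    rw [LinearMap.id_apply, h1, assoc_map, ρ.coassoc, map_map, map_map, LinearMap.id_comp,
      LinearMap.comp_id, LinearMap.id_comp, LinearMap.comp_id]
  | add x y hx hy => simp only [map_add, hx, hy]

/-- The map `P → Hom^C(S, P ⊗_B S)`, `p ↦ p ⊗ -`, where `B = End^C(S)`. -/
def homUnit (ρ : Coaction A C S) (P : Type*) [AddCommGroup P] [Module (endRing ρ)ᵐᵒᵖ P] :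
    P →ₗ[(endRing ρ)ᵐᵒᵖ] hom ρ (tensorCoaction ρ P) where
  toFun p :=
    ⟨{ toFun := fun s => tmul (endRing ρ) p s
       map_add' := tmul_add p
       map_smul' := fun _ _ => rfl }, fun s => by
      change (assoc (endRing ρ) A P S C).symm (tmul (endRing ρ) p (ρ.toLin s)) = _
      induction ρ.toLin s using NCTensor.induction_on with
      | zero => simp only [tmul_zero, map_zero]
      | tmul q c => rfl
      | add x y hx hy => simp only [tmul_add, map_add, hx, hy]⟩
  map_add' p q := Subtype.ext (LinearMap.ext fun s => add_tmul p q s)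
  map_smul' b p := Subtype.ext (LinearMap.ext fun s => smul_tmul (unop b) p s)

/-- The evaluation map `Hom^C(S, X) ⊗_B S → X`, where `B = End^C(S)`. -/
def homEval (ρ : Coaction A C S) (F : Coaction A C X) :
    NCTensor (endRing ρ) (hom ρ F) S →ₗ[Aᵐᵒᵖ] X where
  toFun := lift
    (AddMonoidHom.mk' (fun f => f.1.toAddMonoidHom) (fun _ _ => rfl)) (fun _ _ _ => rfl)
  map_add' := map_add _
  map_smul' a x := by
    induction x using NCTensor.induction_on with
    | zero => simp
    | tmul f q => exact f.1.map_smul a q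
    | add x y hx hy => simp only [smul_add, map_add, hx, hy]

theorem homEval_tmul (ρ : Coaction A C S) (F : Coaction A C X) (f : hom ρ F) (s : S) :
    homEval ρ F (tmul (endRing ρ) f s) = f.1 s := rfl

theorem isColinear_homEval (ρ : Coaction A C S) (F : Coaction A C X) :
    IsColinear (tensorCoaction ρ (hom ρ F)) F (homEval ρ F) := fun x => by
  induction x using NCTensor.induction_on with
  | zero => simp only [map_zero]
  | tmul f s =>
    -- Colinearity of `f ⊗ -` computes the induced coaction on a pure tensor.
    have h := (homUnit ρ (hom ρ F) f).2 s
    change (tensorCoaction ρ (hom ρ F)).toLin (tmul (endRing ρ) f s) = _ at h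
    rw [h, map_map, homEval_tmul, f.2]
    rfl
  | add x y hx hy => simp only [map_add, hx, hy]

theorem isColinear_rTensor (ρ : Coaction A C S) {P P' : Type*} [AddCommGroup P]
    [Module (endRing ρ)ᵐᵒᵖ P] [AddCommGroup P'] [Module (endRing ρ)ᵐᵒᵖ P']
    (e : P →ₗ[(endRing ρ)ᵐᵒᵖ] P') :
    IsColinear (tensorCoaction ρ P) (tensorCoaction ρ P') (rTensor S e) := fun x => by
  induction x using NCTensor.induction_on with
  | zero => simp only [map_zero]
  | tmul p s =>
    have h := (homUnit ρ P p).2 s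
    have h' := (homUnit ρ P' (e p)).2 s
    change (tensorCoaction ρ P).toLin (tmul (endRing ρ) p s) = _ at h
    change (tensorCoaction ρ P').toLin (tmul (endRing ρ) (e p) s) = _ at h'
    rw [h, map_map]
    exact h'
  | add x y hx hy => simp only [map_add, hx, hy]

/-- The left square of the comparison between the tensored kernel sequence and `X → X ⊗ C`; on pure
tensors it is colinearity of `g`. -/
theorem cofreeEval_homIncl (ρ : Coaction A C S) (F : Coaction A C X)
    (t : NCTensor (endRing ρ) (hom ρ F) S) :
    cofreeEval ρ X (map (homIncl ρ F) LinearMap.id t) = F.toLin (homEval ρ F t) := by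
  induction t using NCTensor.induction_on with
  | zero => simp only [map_zero]
  | tmul g s => exact (g.2 s).symm
  | add x y hx hy => simp only [map_add, hx, hy]

end Hom

/-! ### Bijectivity of `cofreeEval` for a Galois comodule -/

section Dual

variable {A C S X : Type*} [Ring A] [AddCommGroup C] [Module A C] [Module Aᵐᵒᵖ C]
  [SMulCommClass A Aᵐᵒᵖ C] [Coring A C] [AddCommGroup S] [Module Aᵐᵒᵖ S]
  [AddCommGroup X] [Module Aᵐᵒᵖ X]

/-- The right linear map `lid : A ⊗_A C → C`. -/
def lidRight (A C : Type*) [Ring A] [AddCommGroup C] [Module A C] [Module Aᵐᵒᵖ C]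
    [SMulCommClass A Aᵐᵒᵖ C] : NCTensor A A C →ₗ[Aᵐᵒᵖ] C where
  toFun := lid
  map_add' := map_add _
  map_smul' a x := by
    induction x using NCTensor.induction_on with
    | zero => simp
    | tmul b c => exact smul_comm b a c
    | add x y hx hy => simp only [smul_add, map_add, hx, hy]

theorem comul_lid (x : NCTensor A A C) :
    (Coring.comul (A := A) (C := C)).left (lid x) =
      map (lidRight A C) LinearMap.id ((assoc A A A C C).symm
        (map LinearMap.id (Coring.comul (A := A) (C := C)).left x)) := by
  induction x using NCTensor.induction_on with
  | zero => simp only [map_zero]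
  | tmul a c =>
    rw [lid_tmul, map_smul, map_tmul, LinearMap.id_apply]
    induction (Coring.comul (A := A) (C := C)).left c using NCTensor.induction_on with
    | zero => simp only [tmul_zero, smul_zero, map_zero]
    | tmul c d => rfl
    | add x y hx hy => simp only [smul_add, tmul_add, map_add, hx, hy]
  | add x y hx hy => simp only [map_add, hx, hy]

/-- The case `X = A` of `cofreeEval_cofree`, read through `A ⊗_A C ≃ C`; `comul_lid` supplies the
compatibility with `Δ`. -/
theorem isColinear_lid_cofree (ρ : Coaction A C S) (g : S →ₗ[Aᵐᵒᵖ] A) :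
    IsColinear ρ (regular A C) (lidRight A C ∘ₗ cofree ρ A g) := fun s => by
  change (Coring.comul (A := A) (C := C)).left (lid (cofree ρ A g s)) = _
  have h := cofreeEval_cofree ρ (tmul (endRing ρ) g s)
  rw [map_tmul, cofreeEval_tmul, cofreeEval_tmul, LinearMap.id_apply] at h
  rw [comul_lid, cofree_apply, ← h, AddEquiv.symm_apply_apply, map_map, LinearMap.id_comp]

theorem counit_lid_cofree (ρ : Coaction A C S) (g : S →ₗ[Aᵐᵒᵖ] A) (s : S) :
    (Coring.counit (A := A) (C := C)).left (lid (cofree ρ A g s)) = g s := by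
  conv_rhs => rw [← ρ.counit s]
  rw [cofree_apply]
  induction ρ.toLin s using NCTensor.induction_on with
  | zero => simp only [map_zero]
  | tmul s c => simp
  | add x y hx hy => simp only [map_add, hx, hy]

/-- The isomorphism `Hom_A(S, A) ≃ Hom^C(S, C)`, `g ↦ (g ⊗ C) ∘ ρ`. -/
def dualEquiv (ρ : Coaction A C S) :
    (S →ₗ[Aᵐᵒᵖ] A) ≃ₗ[(endRing ρ)ᵐᵒᵖ] hom ρ (regular A C) where
  toFun g := ⟨lidRight A C ∘ₗ cofree ρ A g, isColinear_lid_cofree ρ g⟩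
  invFun f := (Coring.counit (A := A) (C := C)).right ∘ₗ f.1
  left_inv g := LinearMap.ext fun s => counit_lid_cofree ρ g s
  right_inv f := Subtype.ext (LinearMap.ext fun s => by
    -- By colinearity of `f`, `(εf ⊗ C) ρ = (ε ⊗ C) Δ f`, and the left counit law reduces this to
    -- `f`.
    have h : map (Coring.counit (A := A) (C := C)).right LinearMap.id
        (map f.1 LinearMap.id (ρ.toLin s)) = map ((Coring.counit (A := A) (C := C)).right ∘ₗ f.1)
          (LinearMap.id : C →ₗ[A] C) (ρ.toLin s) := by rw [map_map, LinearMap.id_comp]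
    rw [← f.2 s] at h
    exact (congrArg lid h.symm).trans (Coring.counit_left (f.1 s)))
  map_add' g h := Subtype.ext (by simp only [map_add, LinearMap.comp_add]; rfl)
  map_smul' b g := Subtype.ext (by simp only [map_smul]; rfl)

/-- The map `A → X`, `a ↦ x a`. -/
def orbitMap (A : Type*) [Ring A] {X : Type*} [AddCommGroup X] [Module Aᵐᵒᵖ X] (x : X) :
    A →ₗ[Aᵐᵒᵖ] X where
  toFun a := op a • x
  map_add' a b := by rw [op_add, add_smul]
  map_smul' a b := by simp [mul_smul]

theorem orbitMap_add (x y : X) : orbitMap A (x + y) = orbitMap A x + orbitMap A y :=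
  LinearMap.ext fun _ => smul_add _ _ _

theorem orbitMap_smul (a : A) (x : X) :
    orbitMap A (op a • x) = orbitMap A x ∘ₗ orbitMap A a :=
  LinearMap.ext fun b => by simp [orbitMap, mul_smul]

/-- The isomorphism `Hom_A(S, A) ⊗_B S ≃ C`, for a Galois comodule `S`. -/
def dualEval (ρ : Coaction A C S) (h : ρ.IsGalois) :
    NCTensor (endRing ρ) (S →ₗ[Aᵐᵒᵖ] A) S ≃+ C :=
  (rTensorEquiv A S (dualEquiv ρ)).toAddEquiv.trans
    (LinearEquiv.ofBijective (evaluation ρ) h.bijective).toAddEquiv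

/-- This is where the Galois isomorphism is recognised as the case `X = A` of `cofreeEval`. -/
theorem dualEval_apply (ρ : Coaction A C S) (h : ρ.IsGalois)
    (t : NCTensor (endRing ρ) (S →ₗ[Aᵐᵒᵖ] A) S) :
    dualEval ρ h t = lid (cofreeEval ρ A t) := by
  induction t using NCTensor.induction_on with
  | zero => simp only [map_zero]
  | tmul g s => rfl
  | add x y hx hy => simp only [map_add, hx, hy]

theorem map_orbitMap {A C X : Type*} [Ring A] [AddCommGroup C] [Module A C]
    [AddCommGroup X] [Module Aᵐᵒᵖ X] (x : X) (z : NCTensor A A C) :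
    map (orbitMap A x) LinearMap.id z = tmul A x (lid z) := by
  induction z using NCTensor.induction_on with
  | zero => simp only [map_zero, tmul_zero]
  | tmul a c => exact smul_tmul a x c
  | add x y hx hy => simp only [map_add, tmul_add, hx, hy]

theorem cofreeEval_orbitMap (ρ : Coaction A C S) (h : ρ.IsGalois) (x : X)
    (t : NCTensor (endRing ρ) (S →ₗ[Aᵐᵒᵖ] A) S) :
    cofreeEval ρ X (map (postcomp ρ (orbitMap A x)) LinearMap.id t)
      = tmul A x (dualEval ρ h t) := by
  rw [cofreeEval_postcomp, map_orbitMap, dualEval_apply]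

/-- Left `A`-linearity of `dualEval`: `orbitMap A a` is left multiplication by `a` on `A`, so
postcomposition with it is the left action on `Hom_A(S, A)`. It makes `cofreeEvalInv` balanced over
`A`. -/
theorem dualEval_postcomp_orbitMap (ρ : Coaction A C S) (h : ρ.IsGalois) (a : A)
    (t : NCTensor (endRing ρ) (S →ₗ[Aᵐᵒᵖ] A) S) :
    dualEval ρ h (map (postcomp ρ (orbitMap A a)) LinearMap.id t) = a • dualEval ρ h t := by
  rw [dualEval_apply, cofreeEval_orbitMap ρ h, lid_tmul]

/-- The map `X ⊗_A C → Hom_A(S, X) ⊗_B S` inverse to `cofreeEval`. -/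
def cofreeEvalInv (ρ : Coaction A C S) (h : ρ.IsGalois) (X : Type*) [AddCommGroup X]
    [Module Aᵐᵒᵖ X] : NCTensor A X C →+ NCTensor (endRing ρ) (S →ₗ[Aᵐᵒᵖ] X) S :=
  lift
    (AddMonoidHom.mk'
      (fun x => (map (postcomp ρ (orbitMap A x)) LinearMap.id).comp
        (dualEval ρ h).symm.toAddMonoidHom)
      (fun x y => by
        have hp : postcomp ρ (orbitMap A (x + y))
            = postcomp ρ (orbitMap A x) + postcomp ρ (orbitMap A y) := by
          rw [orbitMap_add]
          exact LinearMap.ext fun g => LinearMap.add_comp _ _ _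
        ext c
        simp only [hp, AddMonoidHom.comp_apply, AddMonoidHom.add_apply]
        exact map_add_id _ _ _))
    (fun x a c => by
      change map (postcomp ρ (orbitMap A (op a • x))) LinearMap.id ((dualEval ρ h).symm c)
        = map (postcomp ρ (orbitMap A x)) LinearMap.id ((dualEval ρ h).symm (a • c))
      have hc : (dualEval ρ h).symm (a • c)
          = map (postcomp ρ (orbitMap A a)) LinearMap.id ((dualEval ρ h).symm c) := by
        rw [AddEquiv.symm_apply_eq, dualEval_postcomp_orbitMap, AddEquiv.apply_symm_apply]
      rw [hc, map_map, orbitMap_smul]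
      rfl)

theorem cofreeEvalInv_tmul (ρ : Coaction A C S) (h : ρ.IsGalois) (x : X) (c : C) :
    cofreeEvalInv ρ h X (tmul A x c)
      = map (postcomp ρ (orbitMap A x)) LinearMap.id ((dualEval ρ h).symm c) := rfl

theorem cofreeEval_cofreeEvalInv (ρ : Coaction A C S) (h : ρ.IsGalois) (z : NCTensor A X C) :
    cofreeEval ρ X (cofreeEvalInv ρ h X z) = z := by
  induction z using NCTensor.induction_on with
  | zero => simp only [map_zero]
  | tmul x c => rw [cofreeEvalInv_tmul, cofreeEval_orbitMap ρ h, AddEquiv.apply_symm_apply]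
  | add x y hx hy => simp only [map_add, hx, hy]

/-- A finitely generated projective right module has a finite dual basis. -/
theorem exists_dual_basis (A S : Type*) [Ring A] [AddCommGroup S] [Module Aᵐᵒᵖ S]
    [Module.Finite Aᵐᵒᵖ S] [Module.Projective Aᵐᵒᵖ S] :
    ∃ (n : ℕ) (e : Fin n → S) (d : Fin n → S →ₗ[Aᵐᵒᵖ] A),
      ∀ s, ∑ i, op (d i s) • e i = s := by
  obtain ⟨n, p, hp⟩ := Module.Finite.exists_fin' Aᵐᵒᵖ S
  -- Projectivity splits the surjection `p` from a free module; the coordinates of the section `q`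
  -- are the dual functionals.
  obtain ⟨q, hq⟩ := Module.projective_lifting_property p LinearMap.id hp
  let u : Aᵐᵒᵖ →ₗ[Aᵐᵒᵖ] A :=
    { toFun := unop, map_add' := fun _ _ => rfl, map_smul' := fun _ _ => rfl }
  refine ⟨n, fun i => p (Pi.single i 1), fun i => u ∘ₗ LinearMap.proj i ∘ₗ q, fun s => ?_⟩
  have h : ∀ v, ∑ i, v i • p (Pi.single i 1) = p v := fun v => by
    rw [LinearMap.pi_apply_eq_sum_univ p v]
    refine Finset.sum_congr rfl fun i _ => ?_
    congr 2
    ext j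
    simp [Pi.single_apply, eq_comm]
  exact (h (q s)).trans (DFunLike.congr_fun hq s)

/-- A dual basis writes `f` as a sum of maps factoring through `A`. For such maps the claim reduces
by naturality to the inverse of `dualEval`. -/
theorem cofreeEvalInv_cofreeEval (ρ : Coaction A C S) (h : ρ.IsGalois)
    (t : NCTensor (endRing ρ) (S →ₗ[Aᵐᵒᵖ] X) S) :
    cofreeEvalInv ρ h X (cofreeEval ρ X t) = t := by
  induction t using NCTensor.induction_on with
  | zero => simp only [map_zero]
  | add x y hx hy => simp only [map_add, hx, hy]
  | tmul f s =>
    have := h.finite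
    have := h.projective
    obtain ⟨n, e, d, hd⟩ := exists_dual_basis A S
    let T : (S →ₗ[Aᵐᵒᵖ] X) →+ NCTensor (endRing ρ) (S →ₗ[Aᵐᵒᵖ] X) S :=
      AddMonoidHom.mk' (fun g => tmul (endRing ρ) g s) (fun g g' => add_tmul g g' s)
    have hf : f = ∑ i, orbitMap A (f (e i)) ∘ₗ d i := by
      ext s
      conv_lhs => rw [← hd s]
      rw [map_sum, LinearMap.sum_apply]
      exact Finset.sum_congr rfl fun i _ => f.map_smul _ _
    have key : ∀ x (g : S →ₗ[Aᵐᵒᵖ] A),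
        cofreeEvalInv ρ h X (cofreeEval ρ X (T (orbitMap A x ∘ₗ g)))
          = T (orbitMap A x ∘ₗ g) := by
      intro x g
      change cofreeEvalInv ρ h X (cofreeEval ρ X
        (map (postcomp ρ (orbitMap A x)) LinearMap.id (tmul (endRing ρ) g s))) = _
      rw [cofreeEval_orbitMap ρ h, cofreeEvalInv_tmul, AddEquiv.symm_apply_apply]
      rfl
    change cofreeEvalInv ρ h X (cofreeEval ρ X (T f)) = T f
    rw [hf]
    simp only [map_sum, key]

end Dual

/-! ### The counit and unit of the equivalence are bijective -/

section Equivalence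

variable {A C S X : Type u} [Ring A] [AddCommGroup C] [Module A C] [Module Aᵐᵒᵖ C]
  [SMulCommClass A Aᵐᵒᵖ C] [Coring A C] [AddCommGroup S] [Module Aᵐᵒᵖ S]
  [AddCommGroup X] [Module Aᵐᵒᵖ X]

/-- Injectivity holds because `F ∘ homEval` is the composite of the injective maps `homIncl ⊗ S` and
`cofreeEval`. For surjectivity, `F x` is lifted along `cofreeEval`, and coassociativity of `F`
places the lift in the kernel, hence in the image of `Hom^C(S, X) ⊗_B S`. -/
theorem homEval_bijective (ρ : Coaction A C S) (hG : ρ.IsGalois)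
    (hflat : FaithfullyFlat ρ.endRing S) (F : Coaction A C X) :
    Function.Bijective (homEval ρ F) := by
  have hβ : ∀ (Y : Type u) [AddCommGroup Y] [Module Aᵐᵒᵖ Y],
      Function.Injective (cofreeEval ρ Y) := fun Y _ _ =>
    Function.LeftInverse.injective (cofreeEvalInv_cofreeEval ρ hG)
  have hi : Function.Injective (map (homIncl ρ F) (LinearMap.id : S →ₗ[ρ.endRing] S)) :=
    (hflat.injective_iff _).2 Subtype.val_injective
  refine ⟨fun t t' h => hi (hβ X ?_), fun x => ?_⟩
  · rw [cofreeEval_homIncl, cofreeEval_homIncl, h]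
  -- The kernel of the difference consists of the `f` with `F ∘ f = (f ⊗ C) ∘ ρ`, that is, the
  -- colinear maps.
  · have hex : Function.Exact (homIncl ρ F) (postcomp ρ F.toLin - cofree ρ X) := fun f => by
      rw [LinearMap.sub_apply, sub_eq_zero]
      exact ⟨fun hf => ⟨⟨f, fun s => DFunLike.congr_fun hf s⟩, rfl⟩,
        fun ⟨g, hg⟩ => by rw [← hg]; exact LinearMap.ext g.2⟩
    let t := cofreeEvalInv ρ hG X (F.toLin x)
    have ht : cofreeEval ρ X t = F.toLin x := cofreeEval_cofreeEvalInv ρ hG _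
    -- Injectivity of `cofreeEval` for `X ⊗ C` reduces this equality to coassociativity of `F` at
    -- `x`.
    have hd : map (postcomp ρ F.toLin) (LinearMap.id : S →ₗ[ρ.endRing] S) t
        = map (cofree ρ X) LinearMap.id t := by
      apply hβ
      apply (assoc A A X C C).injective
      rw [cofreeEval_cofree, cofreeEval_postcomp, ht]
      exact F.coassoc x
    have h0 : map (postcomp ρ F.toLin - cofree ρ X) (LinearMap.id : S →ₗ[ρ.endRing] S) t = 0 := by
      have h := map_add_id (postcomp ρ F.toLin - cofree ρ X) (cofree ρ X) t
      rw [sub_add_cancel, hd] at h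
      exact left_eq_add.1 (h.trans (add_comm _ _))
    obtain ⟨u, hu⟩ := ((hflat _ _ _ _ _).1 hex t).1 h0
    refine ⟨u, F.toLin_injective ?_⟩
    rw [← cofreeEval_homIncl, hu, ht]

/-- The evaluation isomorphism `Hom^C(S, X) ⊗_B S ≃ X`. -/
def homEvalEquiv (ρ : Coaction A C S) (hG : ρ.IsGalois)
    (hflat : FaithfullyFlat ρ.endRing S) (F : Coaction A C X) :
    NCTensor ρ.endRing (hom ρ F) S ≃ₗ[Aᵐᵒᵖ] X :=
  LinearEquiv.ofBijective (homEval ρ F) (homEval_bijective ρ hG hflat F)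

theorem isColinear_homEvalEquiv (ρ : Coaction A C S) (hG : ρ.IsGalois)
    (hflat : FaithfullyFlat ρ.endRing S) (F : Coaction A C X) :
    IsColinear (tensorCoaction ρ (hom ρ F)) F (homEvalEquiv ρ hG hflat F).toLinearMap :=
  isColinear_homEval ρ F

/-- By the triangle identity `hid`, `homUnit ⊗ S` is a right inverse of the injective map `homEval`,
so it is bijective; faithful flatness removes the factor `S`. -/
theorem homUnit_bijective (ρ : Coaction A C S) (hG : ρ.IsGalois)
    (hflat : FaithfullyFlat ρ.endRing S) (P : Type u) [AddCommGroup P] [Module (ρ.endRing)ᵐᵒᵖ P] :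
    Function.Bijective (homUnit ρ P) := by
  have hb := homEval_bijective ρ hG hflat (tensorCoaction ρ P)
  have hid : ∀ x, homEval ρ (tensorCoaction ρ P) (map (homUnit ρ P) LinearMap.id x) = x := by
    intro x
    induction x using NCTensor.induction_on with
    | zero => simp only [map_zero]
    | tmul p s => rfl
    | add x y hx hy => simp only [map_add, hx, hy]
  exact ⟨(hflat.injective_iff _).1 (Function.LeftInverse.injective hid),
    hflat.surjective_of_map _ fun y => ⟨_, hb.1 (hid (homEval ρ (tensorCoaction ρ P) y))⟩⟩

end Equivalence

/-! ### Coactions on `N ⊗_B S` and twisted forms of `N` -/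

section Twist

variable {A C S N : Type u} [Ring A] [AddCommGroup C] [Module A C] [Module Aᵐᵒᵖ C]
  [SMulCommClass A Aᵐᵒᵖ C] [Coring A C] [AddCommGroup S] [Module Aᵐᵒᵖ S]

/-- The twisted form `Hom^C(S, (N ⊗_B S, F))` of `N` given by a coaction `F` on `N ⊗_B S`. -/
def toTwist (ρ : Coaction A C S) (hG : ρ.IsGalois) (hflat : FaithfullyFlat ρ.endRing S)
    [AddCommGroup N] [Module (ρ.endRing)ᵐᵒᵖ N] (F : Coaction A C (NCTensor ρ.endRing N S)) :
    Twist A ρ.endRing S N :=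
  Quotient.mk (TwistedForm.setoid A ρ.endRing S N) ⟨hom ρ F, homEvalEquiv ρ hG hflat F⟩

variable (ρ : Coaction A C S) (hG : ρ.IsGalois) (hflat : FaithfullyFlat ρ.endRing S)
  [AddCommGroup N] [Module (ρ.endRing)ᵐᵒᵖ N]

/-- A `B`-isomorphism `e` of the Hom modules gives the automorphism `e ⊗ S` of `N ⊗_B S`, conjugated
by the evaluation isomorphisms and so colinear from `F` to `G`. Conversely, a colinear automorphism
acts on Hom by composition. -/
theorem toTwist_eq_iff (F G : Coaction A C (NCTensor ρ.endRing N S)) :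
    toTwist ρ hG hflat F = toTwist ρ hG hflat G ↔ DescentD1.mk F = DescentD1.mk G := by
  refine Quotient.eq.trans (Iff.trans ?_ Quotient.eq.symm)
  constructor
  · rintro ⟨e⟩
    change hom ρ F ≃ₗ[(endRing ρ)ᵐᵒᵖ] hom ρ G at e
    let f := (homEvalEquiv ρ hG hflat F).symm.trans
      ((rTensorEquiv A S e).trans (homEvalEquiv ρ hG hflat G))
    have hf : IsColinear F G f.toLinearMap :=
      ((isColinear_homEvalEquiv ρ hG hflat G).comp
        (isColinear_rTensor ρ e.toLinearMap)).comp (isColinear_homEvalEquiv ρ hG hflat F).symm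
    exact ⟨op f, hf.pullback_eq⟩
  · rintro ⟨f, hf⟩
    have h : IsColinear F G (unop f).toLinearMap := by
      rw [← hf]
      exact isColinear_pullback (unop f) G
    exact ⟨homCongr ρ (unop f) h⟩

/-- The chain `P ≃ Hom^C(S, P ⊗_B S) ≃ Hom^C(S, (N ⊗_B S, F))` uses the unit and then `P.iso`. It
serves both surjectivity and the base point. -/
theorem toTwist_eq_mk (P : TwistedForm A ρ.endRing S N)
    (F : Coaction A C (NCTensor ρ.endRing N S))
    (h : IsColinear (tensorCoaction ρ P.carrier) F P.iso.toLinearMap) :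
    toTwist ρ hG hflat F = Quotient.mk (TwistedForm.setoid A ρ.endRing S N) P :=
  Quotient.sound ⟨((LinearEquiv.ofBijective _
    (homUnit_bijective ρ hG hflat P.carrier)).trans (homCongr ρ P.iso h)).symm⟩

theorem toTwist_surjective :
    Function.Surjective (toTwist (N := N) ρ hG hflat) := by
  intro P
  obtain ⟨P, rfl⟩ := Quotient.exists_rep P
  -- The preimage is the coaction on `N ⊗_B S` that makes `P.iso` colinear.
  exact ⟨pullback P.iso.symm (tensorCoaction ρ P.carrier), toTwist_eq_mk ρ hG hflat P _
    (isColinear_pullback P.iso.symm (tensorCoaction ρ P.carrier)).symm⟩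

end Twist

end Coaction

end

theorem theorem2p4 {A C S : Type u} [Ring A]
    [AddCommGroup C] [Module A C] [Module Aᵐᵒᵖ C] [SMulCommClass A Aᵐᵒᵖ C] [Coring A C]
    [AddCommGroup S] [Module Aᵐᵒᵖ S] (ρ : Coaction A C S)
    (hGalois : ρ.IsGalois) (hflat : NCTensor.FaithfullyFlat ρ.endRing S)
    (N : Type u) [AddCommGroup N] [Module (ρ.endRing)ᵐᵒᵖ N] :
    ∃ e : DescentD1 A C (NCTensor ρ.endRing N S) ≃ Twist A ρ.endRing S N,
      e (DescentD1.mk (ρ.tensorCoaction N)) = Twist.point A ρ.endRing S N := by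
  -- The two directions of `toTwist_eq_iff` give well-definedness and injectivity on `D¹`.
  refine ⟨Equiv.ofBijective (Quotient.lift (toTwist ρ hGalois hflat) fun F G h =>
    (toTwist_eq_iff ρ hGalois hflat F G).2 (Quotient.sound h)) ⟨?_, ?_⟩, ?_⟩
  · intro x y h
    obtain ⟨F, rfl⟩ := Quotient.exists_rep x
    obtain ⟨G, rfl⟩ := Quotient.exists_rep y
    exact (toTwist_eq_iff ρ hGalois hflat F G).1 h
  · intro P
    obtain ⟨F, hF⟩ := toTwist_surjective ρ hGalois hflat P
    exact ⟨DescentD1.mk F, hF⟩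
  · exact toTwist_eq_mk ρ hGalois hflat ⟨N, LinearEquiv.refl _ _⟩ (ρ.tensorCoaction N)
      (fun x => (map_id_id _).symm)
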